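/- Let $M$ be a smooth $m$-dimensional manifold (Hausdorff, second countable, without boundary) with a Poisson tensor $\Pi$, i.e. a smooth bivector field such that $\{f,g\}=\Pi(\mathrm df,\mathrm dg)$ satisfies the Jacobi identity on $C^\infty(M)$, and let $\Pi^\sharp:T^*M\to TM$ be defined by $\beta(\Pi^\sharp\alpha)=\Pi(\alpha,\beta)$. Let $N\subset M$ be a closed (embedded) $n$-dimensional submanifold, and let $T_pN^0\subset T_p^*M$ be the space of covectors that vanish on $T_pN$, for $p\in N$. Put $\mathcal A=C^\infty(M)$, $\mathcal I=\{f\in\mathcal A: f|_N=0\}$ and $\mathcal F=\{f\in\mathcal A:\{f,\mathcal I\}\subset\mathcal I\}$ (the unital subalgebra of first-class functions). Assume that (a) $\dim\bigl(\Pi^\sharp_p(T_pN^0)+T_pN\bigr)$ is the same for all $p\in N$, and (b) $\Pi^\sharp_p(T_pN^0)\cap T_pN=\{0\}$ for all $p\in N$. Then the map $$\phi:\mathcal F/(\mathcal F\cap\mathcal I)\longrightarrow\mathcal A/\mathcal I,\qquad f+\mathcal F\cap\mathcal I\longmapsto f+\mathcal I,$$ is an isomorphism of commutative associative unital real algebras.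 Moreover, restriction to $N$ induces an isomorphism $\mathcal A/\mathcal I\cong C^\infty(N)$, and there is exactly one Poisson bracket $\{\cdot,\cdot\}_N$ on the algebra $C^\infty(N)$ (bilinear, antisymmetric, satisfying the Jacobi identity and the Leibniz rule) such that $$\{f_1|_N,f_2|_N\}_N=\{f_1,f_2\}|_N\qquad\text{for all } f_1,f_2\in\mathcal F.$$ -/

import Mathlib

open scoped Manifold ContDiff

noncomputable section

namespace PoissonReduction

/-! ## Poisson algebras and the algebraic reduction -/

/-- A Poisson bracket on a commutative unital real algebra `A`. -/
structure PoissonBracket (A : Type*) [CommRing A] [Algebra ℝ A] where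
  /-- The bilinear bracket. -/
  bracket : A →ₗ[ℝ] A →ₗ[ℝ] A
  antisymm : ∀ f g : A, bracket f g = -bracket g f
  jacobi : ∀ f g h : A,
    bracket f (bracket g h) + bracket g (bracket h f) + bracket h (bracket f g) = 0
  leibniz : ∀ f g h : A, bracket f (g * h) = g * bracket f h + bracket f g * h

namespace PoissonBracket

variable {A : Type*} [CommRing A] [Algebra ℝ A]

lemma leibniz_left (B : PoissonBracket A) (f g h : A) :
    B.bracket (f * g) h = f * B.bracket g h + B.bracket f h * g := by
  rw [B.antisymm (f * g) h, B.leibniz, B.antisymm h g, B.antisymm h f]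
  ring

lemma bracket_one_left (B : PoissonBracket A) (h : A) : B.bracket 1 h = 0 := by
  have := B.leibniz_left 1 1 h
  simp only [mul_one, one_mul] at this
  simpa using this

/-- The normalizer `F = {f | {f, I} ⊆ I}` of an ideal `I`, i.e. the first-class elements,
as a unital subalgebra of `A`. -/
def firstClass (B : PoissonBracket A) (I : Ideal A) : Subalgebra ℝ A where
  carrier := {f | ∀ h ∈ I, B.bracket f h ∈ I}
  mul_mem' := by
    intro f g hf hg h hh
    rw [B.leibniz_left]
    exact I.add_mem (I.mul_mem_left _ (hg h hh)) (I.mul_mem_right _ (hf h hh))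
  add_mem' := by
    intro f g hf hg h hh
    rw [map_add, LinearMap.add_apply]
    exact I.add_mem (hf h hh) (hg h hh)
  algebraMap_mem' := by
    intro r h _
    rw [Algebra.algebraMap_eq_smul_one, map_smul, LinearMap.smul_apply, B.bracket_one_left,
      smul_zero]
    exact I.zero_mem

/-- `F ∩ I`, as an ideal of the subalgebra `F` of first-class elements. -/
def firstClassConstraints (B : PoissonBracket A) (I : Ideal A) : Ideal (B.firstClass I) :=
  I.comap (B.firstClass I).val

/-- The homomorphism of unital commutative algebras
`F / (F ∩ I) → A / I`, `f + F ∩ I ↦ f + I`. -/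
def phi (B : PoissonBracket A) (I : Ideal A) :
    (B.firstClass I ⧸ B.firstClassConstraints I) →ₐ[ℝ] A ⧸ I :=
  Ideal.quotientMapₐ I (B.firstClass I).val le_rfl

end PoissonBracket

/-! ## Poisson manifolds -/

section Manifold

variable {m : ℕ} {M : Type*} [TopologicalSpace M] [ChartedSpace (EuclideanSpace ℝ (Fin m)) M]

/-- `p ↦ (dg)_p (S_p (df)_p)`, for a field `S` of linear maps `S_p : T*_p M → T_p M`. -/
def bracketFun
    (S : ∀ p : M, (TangentSpace (𝓡 m) p →L[ℝ] ℝ) →L[ℝ] TangentSpace (𝓡 m) p)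
    (f g : M → ℝ) : M → ℝ :=
  fun p => mvfderiv (𝓡 m) g p (S p (mvfderiv (𝓡 m) f p))

variable (m M) in
/-- A Poisson tensor `Π` on a smooth `m`-dimensional manifold `M`: a smooth bivector field `Π`,
given by the smooth bundle map `Π♯ : T*M → TM`, `β (Π♯ α) = Π (α, β)`, such that the bracket
`{f, g} = Π (df, dg) = dg (Π♯ df)` satisfies the Jacobi identity on smooth functions. -/
structure PoissonTensor [IsManifold (𝓡 m) ∞ M] where
  /-- The bundle map `Π♯ : T*M → TM`. -/
  sharp : ∀ p : M, (TangentSpace (𝓡 m) p →L[ℝ] ℝ) →L[ℝ] TangentSpace (𝓡 m) p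
  contMDiff_sharp :
    ContMDiff (𝓡 m)
      ((𝓡 m).prod 𝓘(ℝ, (EuclideanSpace ℝ (Fin m) →L[ℝ] ℝ) →L[ℝ] EuclideanSpace ℝ (Fin m))) ∞
      (fun p => Bundle.TotalSpace.mk'
        ((EuclideanSpace ℝ (Fin m) →L[ℝ] ℝ) →L[ℝ] EuclideanSpace ℝ (Fin m))
        (E := fun q : M =>
          (TangentSpace (𝓡 m) q →L[ℝ] Bundle.Trivial M ℝ q) →L[ℝ] TangentSpace (𝓡 m) q)
        p (sharp p))
  antisymm : ∀ (p : M) (α β : TangentSpace (𝓡 m) p →L[ℝ] ℝ), β (sharp p α) = -α (sharp p β)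
  jacobi : ∀ (f g h : C^∞⟮𝓡 m, M; ℝ⟯) (p : M),
    bracketFun sharp f (bracketFun sharp g h) p + bracketFun sharp g (bracketFun sharp h f) p
      + bracketFun sharp h (bracketFun sharp f g) p = 0

lemma mvfderiv_const_smul (c : ℝ) (f : C^∞⟮𝓡 m, M; ℝ⟯) (p : M) :
    mvfderiv (𝓡 m) (c • (f : M → ℝ)) p = c • mvfderiv (𝓡 m) f p := by
  have h := mvfderiv_smul (I := 𝓡 m) (x := p) (a := fun _ => c) mdifferentiableAt_const
    (f.contMDiff.mdifferentiable (by simp) p)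
  rw [mvfderiv_const] at h
  ext v
  have h' := DFunLike.congr_fun h v
  simp only [add_apply, ContinuousLinearMap.smulRight_apply,
    zero_apply, zero_smul, add_zero] at h'
  exact h'

variable [IsManifold (𝓡 m) ∞ M]

lemma contMDiff_differential {f : M → ℝ} (hf : ContMDiff (𝓡 m) 𝓘(ℝ, ℝ) ∞ f) :
    ContMDiff (𝓡 m) ((𝓡 m).prod 𝓘(ℝ, EuclideanSpace ℝ (Fin m) →L[ℝ] ℝ)) ∞
      (fun p => Bundle.TotalSpace.mk' (EuclideanSpace ℝ (Fin m) →L[ℝ] ℝ)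
        (E := fun q : M => TangentSpace (𝓡 m) q →L[ℝ] Bundle.Trivial M ℝ q)
        p (mvfderiv (𝓡 m) f p)) := by
  intro p
  rw [contMDiffAt_hom_bundle]
  refine ⟨contMDiffAt_id, ?_⟩
  have h := (hf p).mfderiv_const (m := ∞) (by simp)
  convert h using 1
  ext q v
  simp [inTangentCoordinates, ContinuousLinearMap.inCoordinates, mvfderiv]
  rfl

lemma PoissonTensor.contMDiff_bracketFun (P : PoissonTensor m M) {f g : M → ℝ}
    (hf : ContMDiff (𝓡 m) 𝓘(ℝ, ℝ) ∞ f) (hg : ContMDiff (𝓡 m) 𝓘(ℝ, ℝ) ∞ g) :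
    ContMDiff (𝓡 m) 𝓘(ℝ, ℝ) ∞ (bracketFun P.sharp f g) := by
  have h := (contMDiff_differential hg).clm_bundle_apply
    (P.contMDiff_sharp.clm_bundle_apply (contMDiff_differential hf))
  intro p
  exact (Bundle.contMDiffAt_section _).1 (h p)

/-- The Poisson bracket of smooth functions defined by a Poisson tensor. -/
def PoissonTensor.poissonBracket (P : PoissonTensor m M) :
    PoissonBracket C^∞⟮𝓡 m, M; ℝ⟯ where
  bracket := LinearMap.mk₂ ℝ
    (fun f g => ⟨bracketFun P.sharp f g, P.contMDiff_bracketFun f.contMDiff g.contMDiff⟩)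
    (by
      intro f f' g
      ext p
      change bracketFun P.sharp (f + f') g p = bracketFun P.sharp f g p + bracketFun P.sharp f' g p
      have h := mvfderiv_add (f.contMDiff.mdifferentiable (by simp) p)
        (f'.contMDiff.mdifferentiable (by simp) p)
      simp [bracketFun, h])
    (by
      intro c f g
      ext p
      change bracketFun P.sharp (c • (f : M → ℝ)) g p = c • bracketFun P.sharp f g p
      simp [bracketFun, mvfderiv_const_smul])
    (by
      intro f g g'
      ext p
      change bracketFun P.sharp f (g + g') p = bracketFun P.sharp f g p + bracketFun P.sharp f g' p
      have h := mvfderiv_add (g.contMDiff.mdifferentiable (by simp) p)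
        (g'.contMDiff.mdifferentiable (by simp) p)
      simp [bracketFun, h])
    (by
      intro c f g
      ext p
      change bracketFun P.sharp f (c • (g : M → ℝ)) p = c • bracketFun P.sharp f g p
      simp [bracketFun, mvfderiv_const_smul])
  antisymm f g := by
    ext p
    exact P.antisymm p _ _
  jacobi f g h := by
    ext p
    exact P.jacobi f g h p
  leibniz f g h := by
    ext p
    change bracketFun P.sharp f (g * h) p =
      g p * bracketFun P.sharp f h p + bracketFun P.sharp f g p * h p
    have h := mvfderiv_mul (g.contMDiff.mdifferentiable (by simp) p)
        (h.contMDiff.mdifferentiable (by simp) p)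
    simp [bracketFun, h, mul_comm]

lemma PoissonTensor.poissonBracket_apply (P : PoissonTensor m M) (f g : C^∞⟮𝓡 m, M; ℝ⟯) (p : M) :
    P.poissonBracket.bracket f g p =
      mvfderiv (𝓡 m) g p (P.sharp p (mvfderiv (𝓡 m) f p)) := rfl

/-! ## Submanifolds

A submanifold `N` of `M` is given by its inclusion `i : N → M`. -/

variable {n : ℕ} {N : Type*} [TopologicalSpace N] [ChartedSpace (EuclideanSpace ℝ (Fin n)) N]

/-- The restriction homomorphism `C^∞(M) → C^∞(N)`, `f ↦ f ∘ i`. -/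
def restriction (i : C^∞⟮𝓡 n, N; 𝓡 m, M⟯) :
    C^∞⟮𝓡 m, M; ℝ⟯ →ₐ[ℝ] C^∞⟮𝓡 n, N; ℝ⟯ where
  toFun f := f.comp i
  map_one' := rfl
  map_mul' _ _ := rfl
  map_zero' := rfl
  map_add' _ _ := rfl
  commutes' _ := rfl

/-- The ideal of smooth functions on `M` that vanish on `N`. -/
def vanishingIdeal (i : C^∞⟮𝓡 n, N; 𝓡 m, M⟯) : Ideal C^∞⟮𝓡 m, M; ℝ⟯ where
  carrier := {f | ∀ p : N, f (i p) = 0}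
  add_mem' := by
    intro f g hf hg p
    simp [hf p, hg p]
  zero_mem' := fun _ => rfl
  smul_mem' := by
    intro c f hf p
    simp [hf p]

/-- The canonical homomorphism `C^∞(M) / I → C^∞(N)`, `f + I ↦ f ∘ i`. -/
def quotientRestriction (i : C^∞⟮𝓡 n, N; 𝓡 m, M⟯) :
    (C^∞⟮𝓡 m, M; ℝ⟯ ⧸ vanishingIdeal i) →ₐ[ℝ] C^∞⟮𝓡 n, N; ℝ⟯ :=
  Ideal.Quotient.liftₐ (vanishingIdeal i) (restriction i)
    (fun _ hf => ContMDiffMap.ext fun p => hf p)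

/-- The tangent space `T_p N`, as a subspace of `T_p M`. -/
def tangent (i : C^∞⟮𝓡 n, N; 𝓡 m, M⟯) (p : N) : Submodule ℝ (TangentSpace (𝓡 m) (i p)) :=
  LinearMap.range (mfderiv (𝓡 n) (𝓡 m) i p).toLinearMap

/-- The conormal space `T_p N⁰` of covectors on `T_p M` that vanish on `T_p N`. -/
def conormal (i : C^∞⟮𝓡 n, N; 𝓡 m, M⟯) (p : N) :
    Submodule ℝ (TangentSpace (𝓡 m) (i p) →L[ℝ] ℝ) where
  carrier := {α | ∀ v ∈ tangent i p, α v = 0}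
  add_mem' := by
    intro α β hα hβ v hv
    simp [hα v hv, hβ v hv]
  zero_mem' := fun _ _ => rfl
  smul_mem' := by
    intro c α hα v hv
    simp [hα v hv]

/-- The subspace `Π♯ (T_p N⁰)` of `T_p M`. -/
def PoissonTensor.sharpConormal (P : PoissonTensor m M) (i : C^∞⟮𝓡 n, N; 𝓡 m, M⟯) (p : N) :
    Submodule ℝ (TangentSpace (𝓡 m) (i p)) :=
  (conormal i p).map (P.sharp (i p)).toLinearMap

end Manifold

end PoissonReduction

end

noncomputable section

namespace PoissonReduction

/-! ## Linear algebra of the conormal space -/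

section LinearAlgebra

variable {E : Type*} [AddCommGroup E] [Module ℝ E] [TopologicalSpace E] [IsTopologicalAddGroup E]
  [ContinuousSMul ℝ E] [T2Space E] [FiniteDimensional ℝ E]

/-! Everything reduces to one claim: each `f` in `𝒜` becomes first-class after adding some `h ∈ ℐ`
(`exists_correction`). Then `φ` is onto, and `{f|_N, g|_N}_N = {f, g}|_N` for first-class `f, g`
both determines the reduced bracket and defines it, independence of representatives being the
definition of `ℱ` (`existsUnique_reduced`).

Let `C = T_qN⁰`. By antisymmetry and (b), a vector of `Π♯ C` killed by `C` lies in `Π♯ C ∩ T_qN =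
0`. So if constraints `c_a ∈ ℐ` have Hamiltonian vectors forming a basis of `Π♯ C` at `q`, the
matrix `G = ({c_a, c_b})` is invertible at `q`, hence nearby. By (a) and (b) the rank of `Π♯ C` is
constant along `N`, so these vectors still span it at nearby points of `N`. Dirac's correction `h =
-∑ {f, c_a} (G⁻¹)_{ab} c_b` makes `{f + h, c_d}` vanish on `N` near `q`, and by spanning `{f + h,
c}` for every `c ∈ ℐ`. A partition of unity glues the local corrections.

Local retractions onto `N` supply the rest: extension of functions from `N`, constraints with
prescribed conormal differential, and `dim T_qN = n`. -/

lemma mem_of_forall_annihilator {T : Submodule ℝ E} {x : E}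
    (h : ∀ α : E →L[ℝ] ℝ, (∀ v ∈ T, α v = 0) → α x = 0) : x ∈ T := by
  by_contra hx
  obtain ⟨f, hf, hT⟩ := Submodule.exists_le_ker_of_notMem hx
  exact hf (h (LinearMap.toContinuousLinearMap f) fun v hv => hT hv)

/-- An antisymmetric form is nondegenerate on covectors `γ a` in the annihilator `C` of `T` whose
images form a basis of `S C`, if `S C` meets `T` trivially. -/
lemma det_ne_zero_of_basis_image {k : ℕ} {S : (E →L[ℝ] ℝ) →L[ℝ] E}
    (hS : ∀ α β : E →L[ℝ] ℝ, β (S α) = -α (S β)) {T : Submodule ℝ E}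
    {C : Submodule ℝ (E →L[ℝ] ℝ)} (hC : ∀ α, α ∈ C ↔ ∀ v ∈ T, α v = 0)
    (hT : C.map S.toLinearMap ⊓ T = ⊥) {γ : Fin k → E →L[ℝ] ℝ} (hγ : ∀ a, γ a ∈ C)
    (hli : LinearIndependent ℝ fun a => S (γ a))
    (hspan : C.map S.toLinearMap ≤ Submodule.span ℝ (Set.range fun a => S (γ a))) :
    (Matrix.of fun a b => γ b (S (γ a))).det ≠ 0 := by
  intro hd
  obtain ⟨l, hl, hG⟩ := Matrix.exists_vecMul_eq_zero_iff.2 hd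
  apply hl
  set X : E := S (∑ a, l a • γ a) with hX
  have hXγ : ∀ b, γ b X = 0 := by
    intro b
    have := congrFun hG b
    simpa [Matrix.vecMul, dotProduct, hX] using this
  have hXC : X ∈ C.map S.toLinearMap :=
    Submodule.mem_map_of_mem (Submodule.sum_mem _ fun a _ => C.smul_mem _ (hγ a))
  -- For `α ∈ C`, antisymmetry gives `α X = -(∑ l a • γ a) (S α)`. Here `S α` is a combination of
  -- the `S (γ b)`, and there the covector takes the values `-γ b X = 0`.
  have hXT : X ∈ T := by
    refine mem_of_forall_annihilator fun α hα => ?_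
    have hαS : S α ∈ Submodule.span ℝ (Set.range fun a => S (γ a)) :=
      hspan (Submodule.mem_map_of_mem ((hC α).2 hα))
    obtain ⟨μ, hμ⟩ := (Submodule.mem_span_range_iff_exists_fun ℝ).1 hαS
    have h0 : ∀ b, (∑ a, l a • γ a) (S (γ b)) = 0 := by
      intro b
      have := hS (∑ a, l a • γ a) (γ b)
      rw [← hX, hXγ b] at this
      linarith
    rw [hX, hS, ← hμ, map_sum]
    simp only [map_smul, h0, smul_zero, Finset.sum_const_zero, neg_zero]
  have hX0 : X = 0 := by
    have : X ∈ C.map S.toLinearMap ⊓ T := ⟨hXC, hXT⟩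
    rwa [hT, Submodule.mem_bot] at this
  rw [hX, map_sum] at hX0
  simp only [map_smul] at hX0
  funext a
  exact Fintype.linearIndependent_iff.1 hli l hX0 a

omit [IsTopologicalAddGroup E] [ContinuousSMul ℝ E] [T2Space E] in
-- A linear relation among the `S (γ a)` would be a left null vector of the matrix, so these `k`
-- vectors are independent in a space of dimension `k`. This carries the spanning property from one
-- point to its neighbours, where only the determinant is controlled.
lemma map_le_span_of_det_ne_zero {k : ℕ} {S : (E →L[ℝ] ℝ) →L[ℝ] E}
    {C : Submodule ℝ (E →L[ℝ] ℝ)} {γ : Fin k → E →L[ℝ] ℝ} (hγ : ∀ a, γ a ∈ C)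
    (hk : Module.finrank ℝ (C.map S.toLinearMap) = k)
    (hdet : (Matrix.of fun a b => γ b (S (γ a))).det ≠ 0) :
    C.map S.toLinearMap ≤ Submodule.span ℝ (Set.range fun a => S (γ a)) := by
  have hli : LinearIndependent ℝ fun a => S (γ a) := by
    rw [Fintype.linearIndependent_iff]
    intro l hl
    have : Matrix.vecMul l (Matrix.of fun a b => γ b (S (γ a))) = 0 := by
      funext b
      have := congrArg (γ b) hl
      simpa [Matrix.vecMul, dotProduct] using this
    exact congrFun (Matrix.eq_zero_of_vecMul_eq_zero hdet this)
  have hle : Submodule.span ℝ (Set.range fun a => S (γ a)) ≤ C.map S.toLinearMap := by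
    rw [Submodule.span_le]
    rintro _ ⟨a, rfl⟩
    exact Submodule.mem_map_of_mem (hγ a)
  refine (Submodule.eq_of_le_of_finrank_eq hle ?_).ge
  rw [finrank_span_eq_card hli, hk, Fintype.card_fin]

end LinearAlgebra

/-! ## Transfer of the bracket to a quotient -/

section Algebra

variable {A A' : Type*} [CommRing A] [Algebra ℝ A] [CommRing A'] [Algebra ℝ A']

namespace PoissonBracket

lemma ext_bracket {B B' : PoissonBracket A} (h : ∀ f g, B.bracket f g = B'.bracket f g) :
    B = B' := by
  cases B
  cases B'
  congr
  exact LinearMap.ext₂ h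

/-- By the Jacobi identity, as in any normalizer. -/
lemma bracket_mem_firstClass (B : PoissonBracket A) (I : Ideal A) {f g : A}
    (hf : f ∈ B.firstClass I) (hg : g ∈ B.firstClass I) : B.bracket f g ∈ B.firstClass I := by
  intro c hc
  have h := B.jacobi f g c
  have h1 : B.bracket f (B.bracket g c) ∈ I := hf _ (hg c hc)
  have h2 : B.bracket g (B.bracket c f) ∈ I := by
    rw [B.antisymm c f, map_neg]
    exact I.neg_mem (hg _ (hf c hc))
  rw [B.antisymm (B.bracket f g) c, ← neg_eq_of_add_eq_zero_right h, neg_neg]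
  exact I.add_mem h1 h2

/-- The Poisson bracket induced on `A / I` if every element of `A` is congruent to a first-class
element modulo `I`, the quotient being presented by a surjection with kernel `I`. -/
theorem existsUnique_reduced (B : PoissonBracket A) (I : Ideal A) (π : A →ₐ[ℝ] A')
    (hπ : ∀ f, π f = 0 ↔ f ∈ I) (hsurj : ∀ u, ∃ f ∈ B.firstClass I, π f = u) :
    ∃! B' : PoissonBracket A', ∀ f ∈ B.firstClass I, ∀ g ∈ B.firstClass I,
      B'.bracket (π f) (π g) = π (B.bracket f g) := by
  choose s hs hπs using hsurj
  -- The section `s` need not be linear or multiplicative. Each axiom for the new bracket follows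
  -- from independence of the choice of first-class representatives.
  have key : ∀ f ∈ B.firstClass I, ∀ g ∈ B.firstClass I,
      π (B.bracket (s (π f)) (s (π g))) = π (B.bracket f g) := by
    intro f hf g hg
    have h1 : s (π f) - f ∈ I := by rw [← hπ, map_sub, hπs, sub_self]
    have h2 : s (π g) - g ∈ I := by rw [← hπ, map_sub, hπs, sub_self]
    have e : B.bracket (s (π f)) (s (π g)) - B.bracket f g =
        B.bracket (s (π f)) (s (π g) - g) - B.bracket g (s (π f) - f) := by
      rw [B.antisymm g]
      simp only [map_sub, LinearMap.sub_apply]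
      abel
    rw [← sub_eq_zero, ← map_sub, hπ, e]
    exact I.sub_mem (hs _ _ h2) (hg _ h1)
  have key' : ∀ u v f g, f ∈ B.firstClass I → g ∈ B.firstClass I → π f = u → π g = v →
      π (B.bracket (s u) (s v)) = π (B.bracket f g) := by
    rintro _ _ f g hf hg rfl rfl
    exact key f hf g hg
  let b : A' →ₗ[ℝ] A' →ₗ[ℝ] A' := LinearMap.mk₂ ℝ (fun u v => π (B.bracket (s u) (s v)))
    (fun u u' v => by
      rw [key' (u + u') v (s u + s u') (s v) (add_mem (hs u) (hs u')) (hs v)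
        (by rw [map_add, hπs, hπs]) (hπs v), map_add, LinearMap.add_apply, map_add])
    (fun c u v => by
      rw [key' (c • u) v (c • s u) (s v) ((B.firstClass I).smul_mem (hs u) c) (hs v)
        (by rw [map_smul, hπs]) (hπs v), map_smul, LinearMap.smul_apply, map_smul])
    (fun u v v' => by
      rw [key' u (v + v') (s u) (s v + s v') (hs u) (add_mem (hs v) (hs v')) (hπs u)
        (by rw [map_add, hπs, hπs]), map_add, map_add])
    (fun c u v => by
      rw [key' u (c • v) (s u) (c • s v) (hs u) ((B.firstClass I).smul_mem (hs v) c) (hπs u)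
        (by rw [map_smul, hπs]), map_smul, map_smul])
  have hb : ∀ u v, b u v = π (B.bracket (s u) (s v)) := fun _ _ => rfl
  have hbb : ∀ u v w, b u (b v w) = π (B.bracket (s u) (B.bracket (s v) (s w))) := by
    intro u v w
    rw [hb, hb v w]
    exact key' _ _ _ _ (hs u) (B.bracket_mem_firstClass I (hs v) (hs w)) (hπs u) rfl
  refine ⟨⟨b, ?_, ?_, ?_⟩, ?_, ?_⟩
  · intro u v
    rw [hb, hb, B.antisymm, map_neg]
  · intro u v w
    rw [hbb, hbb, hbb, ← map_add, ← map_add, B.jacobi, map_zero]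
  · intro u v w
    rw [hb, key' u (v * w) (s u) (s v * s w) (hs u) (mul_mem (hs v) (hs w)) (hπs u)
      (by rw [map_mul, hπs, hπs]), B.leibniz, map_add, map_mul, map_mul, hπs, hπs, ← hb, ← hb]
  · exact key
  · intro B' hB'
    refine ext_bracket fun u v => ?_
    have := hB' (s u) (hs u) (s v) (hs v)
    rwa [hπs, hπs] at this

/-- Injectivity is automatic, the ideal on the left being the full preimage of `I`; only
surjectivity needs the hypothesis. -/
lemma phi_bijective (B : PoissonBracket A) (I : Ideal A)
    (h : ∀ f : A, ∃ c ∈ I, f + c ∈ B.firstClass I) : Function.Bijective (B.phi I) := by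
  constructor
  · exact Ideal.quotientMap_injective
  · intro x
    obtain ⟨f, rfl⟩ := Ideal.Quotient.mk_surjective x
    obtain ⟨c, hc, hf⟩ := h f
    refine ⟨Ideal.Quotient.mk _ ⟨f + c, hf⟩, ?_⟩
    change Ideal.Quotient.mk I (f + c) = _
    rw [Ideal.Quotient.mk_eq_mk_iff_sub_mem]
    simpa using hc

end PoissonBracket

end Algebra

section Geometry

open Set Filter Topology

variable {m n : ℕ}
  {M : Type*} [TopologicalSpace M] [ChartedSpace (EuclideanSpace ℝ (Fin m)) M]
  {N : Type*} [TopologicalSpace N] [ChartedSpace (EuclideanSpace ℝ (Fin n)) N]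

/-! ## Cut-off and local retractions -/

/-- A function that is smooth on a neighbourhood of `p` agrees near `p` with a smooth function that
vanishes outside of this neighbourhood and at the zeros of the given function. -/
lemma exists_global_of_contMDiffOn [IsManifold (𝓡 m) ∞ M] [T2Space M] {p : M} {V : Set M} (hV : IsOpen V) (hp : p ∈ V)
    {f : M → ℝ} (hf : ContMDiffOn (𝓡 m) 𝓘(ℝ, ℝ) ∞ f V) :
    ∃ F : C^∞⟮𝓡 m, M; ℝ⟯, F =ᶠ[𝓝 p] f ∧ (∀ x, f x = 0 → F x = 0) ∧ ∀ x ∉ V, F x = 0 := by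
  obtain ⟨χ, hχ, -⟩ := (SmoothBumpFunction.nhds_basis_support (I := 𝓡 m)
    (hV.mem_nhds hp)).mem_iff.1 (hV.mem_nhds hp)
  refine ⟨⟨fun x => χ x • f x, contMDiff_of_tsupport fun x hx => ?_⟩, ?_, ?_, ?_⟩
  · exact χ.contMDiffAt.smul
      (hf.contMDiffAt (hV.mem_nhds (hχ (tsupport_smul_subset_left _ _ hx))))
  · filter_upwards [χ.eventuallyEq_one] with x hx
    simp [hx]
  · intro x hx
    simp [hx]
  · intro x hx
    have : χ x = 0 := by
      by_contra h
      exact hx (hχ (subset_tsupport _ h))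
    simp [this]

/-- In charts adapted to the immersion `i` is `x ↦ (x, 0)`, and projection to the first factor
inverts it. -/
lemma exists_local_retraction [IsManifold (𝓡 m) ∞ M] [IsManifold (𝓡 n) ∞ N] {i : N → M}
    (hi : Manifold.IsSmoothEmbedding (𝓡 n) (𝓡 m) ∞ i) (q : N) :
    ∃ V : Set M, IsOpen V ∧ i q ∈ V ∧ ∃ r : M → N, ContMDiffOn (𝓡 m) (𝓡 n) ∞ r V ∧
      ∀ q', i q' ∈ V → r (i q') = q' := by
  have h := hi.isImmersion.isImmersionAt q
  set φ := h.domChart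
  set ψ := h.codChart
  let pr : EuclideanSpace ℝ (Fin m) → EuclideanSpace ℝ (Fin n) := fun y => (h.equiv.symm y).1
  have hpr : ContDiff ℝ ∞ pr := contDiff_fst.comp h.equiv.symm.contDiff
  have key : ∀ q' ∈ φ.source, pr (ψ (i q')) = φ q' := by
    intro q' hq'
    have hm : φ q' ∈ (h.domChart.extend (𝓡 n)).target := by simpa [φ] using φ.map_source hq'
    have hw : ψ (i (φ.symm (φ q'))) = h.equiv (φ q', 0) := by
      simpa [φ, ψ] using h.writtenInCharts hm
    rw [φ.left_inv hq'] at hw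
    simp [pr, hw]
  -- The embedding topology keeps other parts of `N` out of `W`, so the chart identity applies at
  -- every point of `N` over `V`.
  obtain ⟨W, hW, hWφ⟩ := hi.isEmbedding.isOpen_iff.1 φ.open_source
  let V : Set M := W ∩ (ψ.source ∩ ψ ⁻¹' (pr ⁻¹' φ.target))
  have hVo : IsOpen V := hW.inter (ψ.isOpen_inter_preimage (φ.open_target.preimage hpr.continuous))
  have hmem : ∀ q', i q' ∈ W → q' ∈ φ.source := fun q' hq' => hWφ ▸ hq'
  have hqW : i q ∈ W := by
    have : q ∈ i ⁻¹' W := hWφ ▸ h.mem_domChart_source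
    exact this
  refine ⟨V, hVo, ⟨hqW, h.mem_codChart_source, ?_⟩, fun y => φ.symm (pr (ψ y)), ?_, ?_⟩
  · rw [mem_preimage, mem_preimage, key q h.mem_domChart_source]
    exact φ.map_source h.mem_domChart_source
  · have h1 : ContMDiffOn (𝓡 m) (𝓡 m) ∞ ψ V :=
      (contMDiffOn_of_mem_maximalAtlas h.codChart_mem_maximalAtlas).mono fun y hy => hy.2.1
    have h2 := hpr.contMDiff.comp_contMDiffOn h1
    exact (contMDiffOn_symm_of_mem_maximalAtlas h.domChart_mem_maximalAtlas).comp h2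
      fun y hy => hy.2.2
  · intro q' hq'
    have hq := hmem q' hq'.1
    change φ.symm (pr (ψ (i q'))) = q'
    rw [key q' hq, φ.left_inv hq]

lemma restriction_surjective [IsManifold (𝓡 m) ∞ M] [IsManifold (𝓡 n) ∞ N]
    [T2Space M] [SigmaCompactSpace M] {i : C^∞⟮𝓡 n, N; 𝓡 m, M⟯}
    (hi : Manifold.IsSmoothEmbedding (𝓡 n) (𝓡 m) ∞ i) (hclosed : IsClosed (range i)) :
    Function.Surjective (restriction i) := by
  intro g
  -- The constraint on the value at `x` is convex and is vacuous off `N`. Local solutions are `g ∘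
  -- r` near `N` and `0` on the open complement of `N`; a partition of unity averages them.
  have := exists_contMDiffMap_forall_mem_convex_of_local (𝓡 m) (n := ⊤) (M := M) (F := ℝ)
    (t := fun x => {y | ∀ q, i q = x → y = g q}) ?_ ?_
  · obtain ⟨F, hF⟩ := this
    exact ⟨F, ContMDiffMap.ext fun q => hF (i q) q rfl⟩
  · intro x y hy z hz a b _ _ hab q hq
    rw [hy q hq, hz q hq, ← add_smul, hab, one_smul]
  · intro x
    by_cases hx : x ∈ range i
    · obtain ⟨q, rfl⟩ := hx
      obtain ⟨V, hV, hqV, r, hr, hri⟩ := exists_local_retraction hi q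
      refine ⟨V, hV.mem_nhds hqV, fun y => g (r y), g.contMDiff.comp_contMDiffOn hr, ?_⟩
      rintro _ hy q' rfl
      simp only [hri q' hy]
    · refine ⟨(range i)ᶜ, hclosed.isOpen_compl.mem_nhds hx, 0, contMDiffOn_const, ?_⟩
      rintro _ hy q rfl
      exact absurd ⟨q, rfl⟩ hy

/-! ## Covectors that vanish on the submanifold -/

lemma mvfderiv_mem_conormal {i : C^∞⟮𝓡 n, N; 𝓡 m, M⟯} {c : C^∞⟮𝓡 m, M; ℝ⟯}
    (hc : c ∈ vanishingIdeal i) (q : N) : mvfderiv (𝓡 m) c (i q) ∈ conormal i q := by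
  rintro _ ⟨v, rfl⟩
  have h := mvfderiv_comp_apply (f := i) (g := c) q
    (c.contMDiff.mdifferentiable (by simp) (i q)) (i.contMDiff.mdifferentiable (by simp) q) v
  have h0 : (c : M → ℝ) ∘ i = fun _ => 0 := funext hc
  rw [h0, mvfderiv_const] at h
  exact h.symm

lemma mvfderiv_congr {f g : M → ℝ} {p : M} (h : f =ᶠ[𝓝 p] g) :
    mvfderiv (𝓡 m) f p = mvfderiv (𝓡 m) g p := by
  ext v
  simp only [mvfderiv]
  rw [h.mfderiv_eq]
  rfl

/-- Cut off the linear form `α` read in the preferred chart at `p`, whose derivative at `p` is the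
identity. -/
lemma exists_mvfderiv_eq [IsManifold (𝓡 m) ∞ M] [T2Space M] (p : M) (α : TangentSpace (𝓡 m) p →L[ℝ] ℝ) :
    ∃ F : C^∞⟮𝓡 m, M; ℝ⟯, mvfderiv (𝓡 m) F p = α := by
  let β : EuclideanSpace ℝ (Fin m) →L[ℝ] ℝ := α
  obtain ⟨F, hF, -⟩ := exists_global_of_contMDiffOn (p := p)
    (chartAt (EuclideanSpace ℝ (Fin m)) p).open_source (mem_chart_source _ p)
    (f := fun x => β (extChartAt (𝓡 m) p x))
    (β.contMDiff.comp_contMDiffOn (contMDiffOn_extChartAt))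
  refine ⟨F, ?_⟩
  rw [mvfderiv_congr hF]
  ext v
  have h := mvfderiv_comp_apply (f := extChartAt (𝓡 m) p) (g := β) p
    β.mdifferentiableAt (mdifferentiableAt_extChartAt (mem_chart_source _ p)) v
  refine h.trans ?_
  rw [mfderiv_extChartAt_self]
  simp [mvfderiv]
  rfl

lemma mdifferentiableAt_retraction {V : Set M} (hV : IsOpen V) {p : M} (hp : p ∈ V) {r : M → N}
    (hr : ContMDiffOn (𝓡 m) (𝓡 n) ∞ r V) : MDifferentiableAt (𝓡 m) (𝓡 n) r p :=
  (hr.contMDiffAt (hV.mem_nhds hp)).mdifferentiableAt (by simp)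

/-- Take `F` with `dF = α` and cut off `F - F ∘ i ∘ r`. The subtracted term has differential `α ∘ di
∘ dr`, which is zero since `α` kills `T_qN`. -/
lemma exists_mem_vanishingIdeal_mvfderiv_eq [IsManifold (𝓡 m) ∞ M] [IsManifold (𝓡 n) ∞ N]
    [T2Space M] {i : C^∞⟮𝓡 n, N; 𝓡 m, M⟯}
    (hi : Manifold.IsSmoothEmbedding (𝓡 n) (𝓡 m) ∞ i) (q : N)
    {α : TangentSpace (𝓡 m) (i q) →L[ℝ] ℝ} (hα : α ∈ conormal i q) :
    ∃ c ∈ vanishingIdeal i, mvfderiv (𝓡 m) c (i q) = α := by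
  obtain ⟨F, hF⟩ := exists_mvfderiv_eq (i q) α
  obtain ⟨V, hV, hqV, r, hr, hri⟩ := exists_local_retraction hi q
  have hs : ContMDiffOn (𝓡 m) 𝓘(ℝ, ℝ) ∞ (fun x => F (i (r x))) V :=
    (F.contMDiff.comp i.contMDiff).comp_contMDiffOn hr
  obtain ⟨c, hc, hc0, hcV⟩ := exists_global_of_contMDiffOn hV hqV
    (f := fun x => F x - F (i (r x))) (F.contMDiff.contMDiffOn.sub hs)
  refine ⟨c, fun q' => ?_, ?_⟩
  · by_cases h : i q' ∈ V
    · exact hc0 _ (by rw [hri q' h, sub_self])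
    · exact hcV _ h
  · rw [mvfderiv_congr hc]
    have hrd := mdifferentiableAt_retraction hV hqV hr
    have hFd : ∀ x, MDifferentiableAt (𝓡 m) 𝓘(ℝ, ℝ) F x := F.contMDiff.mdifferentiable (by simp)
    have hid : ∀ x, MDifferentiableAt (𝓡 n) (𝓡 m) i x := i.contMDiff.mdifferentiable (by simp)
    have hFi : MDifferentiableAt (𝓡 n) 𝓘(ℝ, ℝ) (F ∘ i) (r (i q)) := (hFd _).comp _ (hid _)
    have e := mvfderiv_fun_sub (hFd (i q)) (hFi.comp _ hrd)
    refine e.trans ?_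
    rw [hF]
    ext v
    have e1 := mvfderiv_comp_apply (f := r) (g := F ∘ i) (i q) hFi hrd v
    have e2 := mvfderiv_comp_apply (f := i) (g := F) (r (i q)) (hFd _) (hid _)
      (mfderiv (𝓡 m) (𝓡 n) r (i q) v)
    have e3 : mvfderiv (𝓡 m) F (i (r (i q)))
        (mfderiv (𝓡 n) (𝓡 m) i (r (i q)) (mfderiv (𝓡 m) (𝓡 n) r (i q) v)) = 0 := by
      rw [hri q hqV, hF]
      exact hα _ ⟨_, rfl⟩
    rw [e2, e3] at e1
    change α v - mvfderiv (𝓡 m) ((F ∘ i) ∘ r) (i q) v = α v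
    rw [e1, sub_zero]

/-- The derivative of a local retraction is a left inverse of `di`. -/
lemma finrank_tangent [IsManifold (𝓡 m) ∞ M] [IsManifold (𝓡 n) ∞ N]
    {i : C^∞⟮𝓡 n, N; 𝓡 m, M⟯}
    (hi : Manifold.IsSmoothEmbedding (𝓡 n) (𝓡 m) ∞ i) (q : N) :
    Module.finrank ℝ (tangent i q) = n := by
  obtain ⟨V, hV, hqV, r, hr, hri⟩ := exists_local_retraction hi q
  have hid : MDifferentiableAt (𝓡 n) (𝓡 m) i q := i.contMDiff.mdifferentiable (by simp) q
  have hinj : Function.Injective (mfderiv (𝓡 n) (𝓡 m) i q) := by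
    have hc := mfderiv_comp q (mdifferentiableAt_retraction hV hqV hr) hid
    have hid' : r ∘ i =ᶠ[𝓝 q] id := by
      filter_upwards [i.contMDiff.continuous.continuousAt.preimage_mem_nhds (hV.mem_nhds hqV)]
        with q' hq' using hri q' hq'
    rw [hid'.mfderiv_eq, mfderiv_id] at hc
    intro v w hvw
    have hv := DFunLike.congr_fun hc v
    have hw := DFunLike.congr_fun hc w
    exact hv.trans ((congrArg _ hvw).trans hw.symm)
  have := LinearMap.finrank_range_of_inj
    (f := (mfderiv (𝓡 n) (𝓡 m) i q).toLinearMap) hinj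
  refine this.trans ?_
  exact finrank_euclideanSpace_fin (𝕜 := ℝ) (n := n)

end Geometry

section Reduction

open Set Filter Topology

variable {m n : ℕ}
  {M : Type*} [TopologicalSpace M] [ChartedSpace (EuclideanSpace ℝ (Fin m)) M]
  {N : Type*} [TopologicalSpace N] [ChartedSpace (EuclideanSpace ℝ (Fin n)) N]

/-! ## Correction of a function to a first-class one -/

variable (m) in
/-- Evaluation of smooth functions at a point. -/
def evalHom (p : M) : C^∞⟮𝓡 m, M; ℝ⟯ →+* ℝ where
  toFun f := f p
  map_one' := rfl
  map_mul' _ _ := rfl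
  map_zero' := rfl
  map_add' _ _ := rfl

variable [IsManifold (𝓡 m) ∞ M]

lemma PoissonTensor.bracket_congr (P : PoissonTensor m M) {f f' : C^∞⟮𝓡 m, M; ℝ⟯} {p : M}
    (h : f =ᶠ[𝓝 p] f') (g : C^∞⟮𝓡 m, M; ℝ⟯) :
    P.poissonBracket.bracket f g p = P.poissonBracket.bracket f' g p := by
  rw [P.poissonBracket_apply, P.poissonBracket_apply, mvfderiv_congr h]

lemma PoissonTensor.bracket_eq_neg (P : PoissonTensor m M) (f g : C^∞⟮𝓡 m, M; ℝ⟯) (p : M) :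
    P.poissonBracket.bracket f g p =
      -mvfderiv (𝓡 m) f p (P.sharp p (mvfderiv (𝓡 m) g p)) := by
  rw [P.poissonBracket_apply, P.antisymm]

/-- The dimension formula for a direct sum gives rank plus `n` equal to `d`, so the natural-number
subtraction is exact. -/
lemma PoissonTensor.finrank_sharpConormal [IsManifold (𝓡 n) ∞ N] (P : PoissonTensor m M)
    {i : C^∞⟮𝓡 n, N; 𝓡 m, M⟯} (hi : Manifold.IsSmoothEmbedding (𝓡 n) (𝓡 m) ∞ i) {d : ℕ} {q : N}
    (ha : Module.finrank ℝ ↥(P.sharpConormal i q ⊔ tangent i q) = d)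
    (hb : P.sharpConormal i q ⊓ tangent i q = ⊥) :
    Module.finrank ℝ (P.sharpConormal i q) = d - n := by
  have : FiniteDimensional ℝ (TangentSpace (𝓡 m) (i q)) :=
    inferInstanceAs (FiniteDimensional ℝ (EuclideanSpace ℝ (Fin m)))
  have h := Submodule.finrank_sup_add_finrank_inf_eq (P.sharpConormal i q) (tangent i q)
  rw [hb, ha, finrank_bot, finrank_tangent hi] at h
  omega

/-- Near a point of the submanifold, functions in the vanishing ideal whose Hamiltonian vectors
form a basis of `Π♯ (T N⁰)` at that point are second-class constraints, and the correction to a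
first-class function is given by the Dirac bracket. -/
lemma PoissonTensor.exists_local_correction [IsManifold (𝓡 n) ∞ N] [T2Space M]
    (P : PoissonTensor m M)
    {i : C^∞⟮𝓡 n, N; 𝓡 m, M⟯} (hi : Manifold.IsSmoothEmbedding (𝓡 n) (𝓡 m) ∞ i) {k : ℕ}
    (hk : ∀ q, Module.finrank ℝ (P.sharpConormal i q) = k)
    (hb : ∀ q, P.sharpConormal i q ⊓ tangent i q = ⊥) (f : C^∞⟮𝓡 m, M; ℝ⟯) (q : N) :
    ∃ U : Set M, IsOpen U ∧ i q ∈ U ∧ ∃ h ∈ vanishingIdeal i, ∀ q', i q' ∈ U →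
      ∀ c ∈ vanishingIdeal i, P.poissonBracket.bracket (f + h) c (i q') = 0 := by
  have hfd : ∀ p : M, FiniteDimensional ℝ (TangentSpace (𝓡 m) p) := fun p =>
    inferInstanceAs (FiniteDimensional ℝ (EuclideanSpace ℝ (Fin m)))
  have : T2Space (TangentSpace (𝓡 m) (i q)) :=
    inferInstanceAs (T2Space (EuclideanSpace ℝ (Fin m)))
  set B := P.poissonBracket with hB
  let b := Module.finBasisOfFinrankEq ℝ (P.sharpConormal i q) (hk q)
  have hc : ∀ a, ∃ c ∈ vanishingIdeal i,
      P.sharp (i q) (mvfderiv (𝓡 m) c (i q)) = (b a : TangentSpace (𝓡 m) (i q)) := by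
    intro a
    obtain ⟨α, hα, hαb⟩ := (b a).2
    obtain ⟨c, hc, rfl⟩ := exists_mem_vanishingIdeal_mvfderiv_eq hi q hα
    exact ⟨c, hc, hαb⟩
  choose c hcI hcb using hc
  let G : Matrix (Fin k) (Fin k) C^∞⟮𝓡 m, M; ℝ⟯ := Matrix.of fun a b => B.bracket (c a) (c b)
  have hdet : ∀ p, G.det p = (Matrix.of fun a b =>
      mvfderiv (𝓡 m) (c b) p (P.sharp p (mvfderiv (𝓡 m) (c a) p))).det :=
    fun p => (evalHom m p).map_det G
  have hq : G.det (i q) ≠ 0 := by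
    rw [hdet]
    have hbc : (fun a => P.sharp (i q) (mvfderiv (𝓡 m) (c a) (i q))) =
        fun a => (b a : TangentSpace (𝓡 m) (i q)) := funext hcb
    refine det_ne_zero_of_basis_image (P.antisymm (i q)) (T := tangent i q) (C := conormal i q)
      (fun _ => Iff.rfl) (hb q) (fun a => mvfderiv_mem_conormal (hcI a) q) ?_ ?_
    · rw [hbc]
      exact b.linearIndependent.map' (P.sharpConormal i q).subtype
        (Submodule.ker_subtype _)
    · rw [hbc]
      intro x hx
      have := congrArg (Submodule.map (P.sharpConormal i q).subtype) b.span_eq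
      rw [Submodule.map_span, ← range_comp, Submodule.map_top, Submodule.range_subtype] at this
      exact this.ge hx
  have hVo : IsOpen {p | G.det p ≠ 0} := isOpen_ne_fun G.det.contMDiff.continuous continuous_const
  -- `F` is a global smooth function equal to `1 / det G` near `i q`.
  obtain ⟨F, hF, -⟩ := exists_global_of_contMDiffOn hVo hq (f := fun p => (G.det p)⁻¹)
    (fun p hp => (G.det.contMDiff p).contMDiffWithinAt.inv₀ hp)
  obtain ⟨U, hUs, hUo, hqU⟩ := mem_nhds_iff.1 (hF.and (hVo.mem_nhds hq))
  -- Dirac's correction with the adjugate in place of `G⁻¹`: it is globally defined, and multiplying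
  -- by `F` later divides by the determinant near `i q`.
  let h : C^∞⟮𝓡 m, M; ℝ⟯ := -∑ b', (∑ a, B.bracket f (c a) * G.adjugate a b') * c b'
  have hhI : h ∈ vanishingIdeal i := (vanishingIdeal i).neg_mem
    (Ideal.sum_mem _ fun b' _ => (vanishingIdeal i).mul_mem_left _ (hcI b'))
  -- On `N` the Leibniz term differentiating the coefficient `v` drops out, because `u` vanishes
  -- there.
  have hmul : ∀ u ∈ vanishingIdeal i, ∀ v w : C^∞⟮𝓡 m, M; ℝ⟯, ∀ q' : N,
      B.bracket (v * u) w (i q') = v (i q') * B.bracket u w (i q') := by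
    intro u hu v w q'
    rw [B.leibniz_left]
    change v (i q') * B.bracket u w (i q') + B.bracket v w (i q') * u (i q') = _
    rw [show u (i q') = 0 from hu q', mul_zero, add_zero]
  have hhc : ∀ d (q' : N), B.bracket h (c d) (i q') =
      -(G.det (i q') * B.bracket f (c d) (i q')) := by
    intro d q'
    have e : ∑ b', (∑ a, B.bracket f (c a) * G.adjugate a b') * G b' d =
        G.det * B.bracket f (c d) := by
      have e1 : Matrix.vecMul (Matrix.vecMul (fun a => B.bracket f (c a)) G.adjugate) G d =
          G.det * B.bracket f (c d) := by
        rw [Matrix.vecMul_vecMul, Matrix.adjugate_mul, Matrix.vecMul_smul, Matrix.vecMul_one]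
        rfl
      exact e1
    have e2 := congrArg (evalHom m (i q')) e
    rw [map_sum] at e2
    rw [map_neg, map_sum, LinearMap.neg_apply, LinearMap.sum_apply]
    change evalHom m (i q') (-_) = _
    rw [map_neg, map_sum]
    refine congrArg Neg.neg (Eq.trans ?_ e2)
    exact Finset.sum_congr rfl fun b' _ => hmul _ (hcI b') _ _ _
  refine ⟨U, hUo, hqU, F * h, (vanishingIdeal i).mul_mem_left _ hhI, fun q' hq' g hg => ?_⟩
  obtain ⟨hFq, hdq⟩ := hUs hq'
  have h0 : ∀ d, mvfderiv (𝓡 m) (f + F * h : C^∞⟮𝓡 m, M; ℝ⟯) (i q')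
      (P.sharp (i q') (mvfderiv (𝓡 m) (c d) (i q'))) = 0 := by
    intro d
    rw [← neg_eq_zero, ← P.bracket_eq_neg, map_add, LinearMap.add_apply]
    change B.bracket f (c d) (i q') + B.bracket (F * h) (c d) (i q') = 0
    rw [hmul h hhI, hhc, hFq]
    field_simp
    ring
  -- The Hamiltonian vectors of the `c d` span `Π♯ (T N⁰)` at `i q'`, so vanishing on them gives
  -- vanishing brackets with all of the ideal.
  have hspan := map_le_span_of_det_ne_zero (S := P.sharp (i q')) (C := conormal i q')
    (γ := fun a => mvfderiv (𝓡 m) (c a) (i q')) (fun a => mvfderiv_mem_conormal (hcI a) q')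
    (hk q') (by rw [← hdet]; exact hdq)
  have hker : Submodule.span ℝ
        (range fun a => P.sharp (i q') (mvfderiv (𝓡 m) (c a) (i q'))) ≤
      LinearMap.ker (mvfderiv (𝓡 m) (f + F * h : C^∞⟮𝓡 m, M; ℝ⟯) (i q')).toLinearMap := by
    rw [Submodule.span_le]
    rintro _ ⟨d, rfl⟩
    exact h0 d
  rw [P.bracket_eq_neg, neg_eq_zero]
  exact hker (hspan (Submodule.mem_map_of_mem (mvfderiv_mem_conormal hg q')))

/-- With `H = ∑ ρ_j h_j`, the derivatives of `ρ_j` do not contribute on `N` because `h_j` vanishes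
there. Hence `{H, c} = ∑ ρ_j {h_j, c} = -{f, c}` on `N`, since `∑ ρ_j = 1` there. -/
lemma PoissonTensor.exists_correction [IsManifold (𝓡 n) ∞ N] [T2Space M] [SigmaCompactSpace M]
    (P : PoissonTensor m M)
    {i : C^∞⟮𝓡 n, N; 𝓡 m, M⟯} (hi : Manifold.IsSmoothEmbedding (𝓡 n) (𝓡 m) ∞ i)
    (hclosed : IsClosed (range i)) {k : ℕ}
    (hk : ∀ q, Module.finrank ℝ (P.sharpConormal i q) = k)
    (hb : ∀ q, P.sharpConormal i q ⊓ tangent i q = ⊥) (f : C^∞⟮𝓡 m, M; ℝ⟯) :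
    ∃ h ∈ vanishingIdeal i, f + h ∈ P.poissonBracket.firstClass (vanishingIdeal i) := by
  choose U hUo hU h hhI hh using P.exists_local_correction hi hk hb f
  obtain ⟨ρ, hρ⟩ := SmoothPartitionOfUnity.exists_isSubordinate (𝓡 m) hclosed U hUo
    (by rintro _ ⟨q, rfl⟩; exact mem_iUnion.2 ⟨q, hU q⟩)
  let H : C^∞⟮𝓡 m, M; ℝ⟯ := ⟨fun x => ∑ᶠ j, ρ j x • h j x,
    ρ.contMDiff_finsum_smul fun j x _ => (h j).contMDiff x⟩
  refine ⟨H, fun q => ?_, fun c hc q => ?_⟩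
  · change ∑ᶠ j, ρ j (i q) • h j (i q) = 0
    refine (finsum_congr fun j => ?_).trans finsum_zero
    rw [show h j (i q) = 0 from hhI j q, smul_zero]
  -- `J` indexes the `ρ j` whose closed support contains `i q`. Near this point only they contribute
  -- to `H`, and subordination puts `i q` in `U j` for each `j ∈ J`.
  · set J := ρ.fintsupport (i q)
    have hH : H =ᶠ[𝓝 (i q)] (∑ j ∈ J, ρ j * h j : C^∞⟮𝓡 m, M; ℝ⟯) := by
      filter_upwards [ρ.eventually_finsupport_subset (i q)] with y hy
      have e : (∑ j ∈ J, ρ j * h j : C^∞⟮𝓡 m, M; ℝ⟯) y = ∑ j ∈ J, ρ j y * h j y :=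
        map_sum (evalHom m y) _ _
      rw [e]
      change ∑ᶠ j, ρ j y • h j y = _
      refine finsum_eq_sum_of_support_subset _ fun j hj => hy ?_
      rw [ρ.mem_finsupport]
      exact fun h0 => hj (by simp [h0])
    have e : P.poissonBracket.bracket (∑ j ∈ J, ρ j * h j) c (i q) =
        ∑ j ∈ J, ρ j (i q) * P.poissonBracket.bracket (h j) c (i q) := by
      rw [map_sum, LinearMap.sum_apply]
      refine (map_sum (evalHom m (i q)) _ _).trans (Finset.sum_congr rfl fun j _ => ?_)
      rw [P.poissonBracket.leibniz_left]
      change ρ j (i q) * _ + _ * h j (i q) = _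
      rw [show h j (i q) = 0 from hhI j q, mul_zero, add_zero]
    have e' : ∀ j ∈ J, ρ j (i q) * P.poissonBracket.bracket (h j) c (i q) =
        ρ j (i q) * -P.poissonBracket.bracket f c (i q) := by
      intro j hj
      have h0 := hh j q (hρ j ((ρ.mem_fintsupport_iff _ j).1 hj)) c hc
      rw [map_add, LinearMap.add_apply] at h0
      rw [eq_neg_of_add_eq_zero_right h0]
    rw [map_add, LinearMap.add_apply]
    change P.poissonBracket.bracket f c (i q) + P.poissonBracket.bracket H c (i q) = 0
    rw [P.bracket_congr hH, e, Finset.sum_congr rfl e', ← Finset.sum_mul,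
      ρ.sum_finsupport' _ (mem_range_self q) (ρ.finsupport_subset_fintsupport _), one_mul,
      add_neg_cancel]

omit [IsManifold (𝓡 m) ∞ M] in
lemma quotientRestriction_bijective {i : C^∞⟮𝓡 n, N; 𝓡 m, M⟯}
    (h : Function.Surjective (restriction i)) : Function.Bijective (quotientRestriction i) := by
  constructor
  · rw [injective_iff_map_eq_zero]
    intro x hx
    obtain ⟨f, rfl⟩ := Ideal.Quotient.mk_surjective x
    exact Ideal.Quotient.eq_zero_iff_mem.2 fun q => DFunLike.congr_fun hx q
  · intro u
    obtain ⟨f, rfl⟩ := h u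
    exact ⟨Ideal.Quotient.mk _ f, rfl⟩

end Reduction
end PoissonReduction
end

theorem mainTheorem1 {m n : ℕ}
    {M : Type*} [TopologicalSpace M] [T2Space M] [SecondCountableTopology M]
    [ChartedSpace (EuclideanSpace ℝ (Fin m)) M] [IsManifold (𝓡 m) ∞ M]
    {N : Type*} [TopologicalSpace N]
    [ChartedSpace (EuclideanSpace ℝ (Fin n)) N] [IsManifold (𝓡 n) ∞ N]
    (P : PoissonReduction.PoissonTensor m M)
    (i : C^∞⟮𝓡 n, N; 𝓡 m, M⟯)
    (hi : Manifold.IsSmoothEmbedding (𝓡 n) (𝓡 m) ∞ i)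
    (hclosed : IsClosed (Set.range i))
    (ha : ∃ d : ℕ, ∀ p : N, Module.finrank ℝ ↥(P.sharpConormal i p ⊔ PoissonReduction.tangent i p) = d)
    (hb : ∀ p : N, P.sharpConormal i p ⊓ PoissonReduction.tangent i p = ⊥) :
    Function.Bijective (P.poissonBracket.phi (PoissonReduction.vanishingIdeal i)) ∧
    Function.Bijective (PoissonReduction.quotientRestriction i) ∧
    ∃! B : PoissonReduction.PoissonBracket C^∞⟮𝓡 n, N; ℝ⟯,
      ∀ f ∈ P.poissonBracket.firstClass (PoissonReduction.vanishingIdeal i),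
      ∀ g ∈ P.poissonBracket.firstClass (PoissonReduction.vanishingIdeal i),
        B.bracket (PoissonReduction.restriction i f) (PoissonReduction.restriction i g) =
          PoissonReduction.restriction i (P.poissonBracket.bracket f g) := by
  -- Together with second countability this gives the σ-compactness behind the partitions of unity.
  have : LocallyCompactSpace M :=
    ChartedSpace.locallyCompactSpace (EuclideanSpace ℝ (Fin m)) M
  obtain ⟨d, hd⟩ := ha
  have hcorr := P.exists_correction hi hclosed
    (fun q => P.finrank_sharpConormal hi (hd q) (hb q)) hb
  have hsurj := PoissonReduction.restriction_surjective hi hclosed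
  refine ⟨P.poissonBracket.phi_bijective _ hcorr,
    PoissonReduction.quotientRestriction_bijective hsurj,
    P.poissonBracket.existsUnique_reduced _ _
      (fun f => ⟨fun h q => DFunLike.congr_fun h q, fun h => ContMDiffMap.ext h⟩) fun u => ?_⟩
  obtain ⟨f, rfl⟩ := hsurj u
  obtain ⟨h, hh, hf⟩ := hcorr f
  refine ⟨f + h, hf, ?_⟩
  have h0 : PoissonReduction.restriction i h = 0 := ContMDiffMap.ext hh
  rw [map_add, h0, add_zero]
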